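/- For a positive semidefinite real matrix $S$ let $S^{1/2}$ be its positive semidefinite square root. Let $N_d(S)$ (resp. $N_{2d}(S)$) be the centered Gaussian measure on $\mathbb{R}^d$ (resp. on $\mathbb{R}^d\times\mathbb{R}^d$) with covariance matrix $S$. For probability measures $\mu,\nu$ on $\mathbb{R}^d$ let $\Pi(\mu,\nu)$ be the set of probability measures on $\mathbb{R}^d\times\mathbb{R}^d$ with marginals $\mu$ and $\nu$. For $\varepsilon>0$ and a positive definite $2d\times 2d$ matrix $\Sigma$ consider the entropic transport problem $$W_\Sigma^\varepsilon(\mu,\nu)=\inf_{\pi\in\Pi(\mu,\nu)}\ \int\|x-y\|^2\,d\pi(x,y)+2\varepsilon\,\mathrm{KL}(\pi\,|\,N_{2d}(\Sigma)),$$ with $\|\cdot\|$ the Euclidean norm, and put $M_\varepsilon=I_d-\varepsilon\,\Gamma_{12}$, where $\Gamma_{12}$ is the upper right $d\times d$ block of $\Sigma^{-1}$. (1) Let $A,B$ be positive definite $d\times d$ matrices, $\mu=N_d(A)$, $\nu=N_d(B)$, $\varepsilon>0$, and let $R_{\mathrm{ref}}$ be a real $d\times d$ matrix with Euclidean operator norm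 $\|R_{\mathrm{ref}}\|_{\mathrm{op}}<1$. Let $$\Sigma=\begin{pmatrix}A & A^{1/2}R_{\mathrm{ref}}B^{1/2}\\ B^{1/2}R_{\mathrm{ref}}^TA^{1/2} & B\end{pmatrix}$$ and assume that $M_\varepsilon$ is invertible. Then $N:=A^{1/2}B^{1/2}+\varepsilon R_{\mathrm{ref}}(I_d-R_{\mathrm{ref}}^TR_{\mathrm{ref}})^{-1}$ is invertible, and with $$C_\varepsilon=A^{1/2}\Big[\Big(NN^T+\tfrac{\varepsilon^2}{4}I_d\Big)^{1/2}-\tfrac{\varepsilon}{2}I_d\Big](N^T)^{-1}B^{1/2}$$ the matrix $\begin{pmatrix}A&C_\varepsilon\\ C_\varepsilon^T&B\end{pmatrix}$ is positive definite, and the Gaussian measure $$\pi_\varepsilon=N_{2d}\begin{pmatrix}A&C_\varepsilon\\ C_\varepsilon^T&B\end{pmatrix}$$ is the unique minimizer of the entropic transport problem between $\mu$ and $\nu$. (2) Let $d=1$, $a,b>0$, $\varepsilon>0$, $\rho\in(-1,1)$, $\mu=N_1(a^2)$, $\nu=N_1(b^2)$, $\Sigma=\begin{pmatrix}a^2&a\rho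 b\\ b\rho a&b^2\end{pmatrix}$, and assume that $M_\varepsilon\neq0$. Then $ab(1-\rho^2)+\varepsilon\rho\ne0$, the unique minimizer is $$\pi_\varepsilon=N_2\begin{pmatrix}a^2&c_\varepsilon\\ c_\varepsilon&b^2\end{pmatrix},\qquad c_\varepsilon=\left(\sqrt{\Big(ab+\tfrac{\varepsilon\rho}{1-\rho^2}\Big)^2+\tfrac{\varepsilon^2}{4}}-\tfrac{\varepsilon}{2}\right)\frac{ab(1-\rho^2)}{ab(1-\rho^2)+\varepsilon\rho},$$ and $W_\Sigma^\varepsilon(\mu,\nu)$ is finite, with $$W_\Sigma^\varepsilon(\mu,\nu)=a^2+b^2-2s+\varepsilon\log\!\Big(s+\frac{\varepsilon}{2}\Big)+\frac{2\varepsilon}{1-\rho^2}-\varepsilon-\varepsilon\log\varepsilon+\varepsilon\log(1-\rho^2),\qquad s=\sqrt{\Big(ab+\tfrac{\varepsilon\rho}{1-\rho^2}\Big)^2+\tfrac{\varepsilon^2}{4}}.$$ -/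

import Mathlib

open MeasureTheory ProbabilityTheory InformationTheory Matrix
open scoped ENNReal MatrixOrder

namespace GaussianEOT

/-- The Euclidean space `ℝᵈ`. -/
abbrev Euc (d : ℕ) : Type := EuclideanSpace ℝ (Fin d)

/-- Real `d × d` matrices. -/
abbrev Mat (d : ℕ) : Type := Matrix (Fin d) (Fin d) ℝ

/-- Real `2d × 2d` matrices, written as `2 × 2` block matrices with `d × d` blocks. -/
abbrev BlockMat (d : ℕ) : Type := Matrix (Fin d ⊕ Fin d) (Fin d ⊕ Fin d) ℝ

/-- `N_d(A)`: the centered Gaussian measure on `ℝᵈ` with covariance matrix `A`. -/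
noncomputable def gaussian {d : ℕ} (A : Mat d) : Measure (Euc d) :=
  multivariateGaussian 0 A

/-- The canonical splitting `ℝ²ᵈ → ℝᵈ × ℝᵈ`. -/
def split {d : ℕ} (z : EuclideanSpace ℝ (Fin d ⊕ Fin d)) : Euc d × Euc d :=
  (WithLp.toLp 2 fun i => z (Sum.inl i), WithLp.toLp 2 fun i => z (Sum.inr i))

/-- `N_{2d}(S)`: the centered Gaussian measure on `ℝᵈ × ℝᵈ` with covariance matrix `S`. -/
noncomputable def gaussianProd {d : ℕ} (S : BlockMat d) : Measure (Euc d × Euc d) :=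
  (multivariateGaussian 0 S).map split

/-- `Π(μ, ν)`: the probability measures on `ℝᵈ × ℝᵈ` with marginals `μ` and `ν`. -/
def couplings {d : ℕ} (μ ν : Measure (Euc d)) : Set (Measure (Euc d × Euc d)) :=
  {π | IsProbabilityMeasure π ∧ π.map Prod.fst = μ ∧ π.map Prod.snd = ν}

/-- The entropic objective `∫ ‖x - y‖² dπ(x, y) + 2 ε KL(π | N_{2d}(S))`, valued in `[0, ∞]`. -/
noncomputable def objective {d : ℕ} (S : BlockMat d) (ε : ℝ) (π : Measure (Euc d × Euc d)) :
    ℝ≥0∞ :=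
  ∫⁻ p, ENNReal.ofReal (‖p.1 - p.2‖ ^ 2) ∂π +
    ENNReal.ofReal (2 * ε) * klDiv π (gaussianProd S)

/-- `π` solves the entropic transport problem between `μ` and `ν`: it is a coupling, and no
coupling has a smaller objective. -/
def IsSolution {d : ℕ} (S : BlockMat d) (ε : ℝ) (μ ν : Measure (Euc d))
    (π : Measure (Euc d × Euc d)) : Prop :=
  π ∈ couplings μ ν ∧ ∀ π' ∈ couplings μ ν, objective S ε π ≤ objective S ε π'

/-- The entropic transport cost `W_S^ε(μ, ν)`, the infimum of the objective over couplings. -/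
noncomputable def cost {d : ℕ} (S : BlockMat d) (ε : ℝ) (μ ν : Measure (Euc d)) : ℝ≥0∞ :=
  ⨅ π ∈ couplings μ ν, objective S ε π

/-- The operator norm of a matrix with respect to the Euclidean norm. -/
noncomputable def opNorm {d : ℕ} (R : Mat d) : ℝ := ‖Matrix.toEuclideanCLM (𝕜 := ℝ) R‖

/-- The matrix with rows `(A, C)` and `(Cᵀ, B)`. -/
def jointCov {d : ℕ} (A B C : Mat d) : BlockMat d := Matrix.fromBlocks A C Cᵀ B

/-- The reference covariance matrix with rows `(A, A^{1/2} R B^{1/2})` and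
`(B^{1/2} Rᵀ A^{1/2}, B)`. -/
noncomputable def refCov {d : ℕ} (A B R : Mat d) : BlockMat d :=
  Matrix.fromBlocks A (CFC.sqrt A * R * CFC.sqrt B) (CFC.sqrt B * Rᵀ * CFC.sqrt A) B

/-- `M_ε = I - ε Γ₁₂`, where `Γ₁₂` is the upper right block of `Γ = S⁻¹`. -/
noncomputable def Meps {d : ℕ} (S : BlockMat d) (ε : ℝ) : Mat d := 1 - ε • (S⁻¹).toBlocks₁₂

/-- `N = A^{1/2} B^{1/2} + ε R (I - Rᵀ R)⁻¹`. -/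
noncomputable def Nmat {d : ℕ} (A B R : Mat d) (ε : ℝ) : Mat d :=
  CFC.sqrt A * CFC.sqrt B + ε • (R * (1 - Rᵀ * R)⁻¹)

/-- `C_ε = A^{1/2} [(N Nᵀ + ε²/4 I)^{1/2} - ε/2 I] (Nᵀ)⁻¹ B^{1/2}`. -/
noncomputable def Ceps {d : ℕ} (A B R : Mat d) (ε : ℝ) : Mat d :=
  CFC.sqrt A *
    (CFC.sqrt (Nmat A B R ε * (Nmat A B R ε)ᵀ + (ε ^ 2 / 4) • (1 : Mat d)) -
      (ε / 2) • (1 : Mat d)) *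
    ((Nmat A B R ε)ᵀ)⁻¹ * CFC.sqrt B

/-- The `2 × 2` covariance matrix with rows `(v, c)` and `(c, w)`, for pairs of real variables. -/
def cov2 (v w c : ℝ) : BlockMat 1 := Matrix.fromBlocks !![v] !![c] !![c] !![w]

end GaussianEOT

open GaussianEOT

/-! Let `S'` be positive definite with diagonal blocks `A`, `B`. The log-density of `N(S')` relative
to `N(S)` is `zᵀ(S⁻¹ - S'⁻¹)z / 2` minus a constant, so changing the reference measure in the
entropy from `S` to `S'` adds the integral of a quadratic form to the cost. If the off-diagonal
block of `S⁻¹ - S'⁻¹` is `ε⁻¹ I`, its cross term cancels the `-2⟨x, y⟩` of `‖x - y‖²`; what remains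
is a function of `x` plus a function of `y`, whose integral is the same for every coupling. Hence
the objective equals a constant plus `2ε KL(π | N(S'))` (`toReal_objective`), and `N(S')`, itself a
coupling, is the unique minimizer (`isSolution_iff`) with that constant as its value.

It remains to find `S'`. With off-diagonal covariance block `A^{1/2} T B^{1/2}`, the precision
condition becomes `(1 - T Tᵀ)⁻¹ T = ε⁻¹ N`, because `M_ε = A^{-1/2} N B^{-1/2}` (`Meps_refCov`). Put
`P = (N Nᵀ + ε²/4)^{1/2} + ε/2`, so that `P² - εP = N Nᵀ`. Then `T = P⁻¹ N` gives `1 - T Tᵀ = ε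
P⁻¹`, which yields both the condition and positive definiteness (`inv_one_sub_optCorr_mul`,
`posDef_one_sub_optCorr`). In dimension one the constant is evaluated from variances and
determinants. -/

namespace GaussianEOT

/-! ### Block matrix algebra: the optimal covariance -/

section Algebra

variable {d : ℕ}

theorem posDef_sqrt {ι : Type*} [Fintype ι] [DecidableEq ι] {A : Matrix ι ι ℝ} (hA : A.PosDef) :
    (CFC.sqrt A).PosDef :=
  (IsStrictlyPositive.sqrt A hA.isStrictlyPositive).posDef

theorem sqrt_mul_self {ι : Type*} [Fintype ι] [DecidableEq ι] {A : Matrix ι ι ℝ}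
    (hA : A.PosDef) : CFC.sqrt A * CFC.sqrt A = A :=
  CFC.sqrt_mul_sqrt_self A hA.posSemidef.nonneg

theorem transpose_eq_self {ι : Type*} [Fintype ι] {A : Matrix ι ι ℝ} (hA : A.PosDef) : Aᵀ = A := by
  simpa using hA.isHermitian.eq

theorem isUnit_det {ι : Type*} [Fintype ι] [DecidableEq ι] {A : Matrix ι ι ℝ} (hA : A.PosDef) :
    IsUnit A.det :=
  (Matrix.isUnit_iff_isUnit_det A).1 hA.isUnit

/-- A strict Euclidean contraction `R` has `1 - R Rᵀ` positive definite. -/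
theorem posDef_one_sub_mul_transpose {R : Mat d} (hR : opNorm R < 1) :
    (1 - R * Rᵀ).PosDef := by
  refine .of_dotProduct_mulVec_pos ?_ fun x hx => ?_
  · simp [Matrix.IsHermitian, Matrix.transpose_mul]
  -- The transpose acts as the adjoint, which has the same operator norm.
  have hnorm : ‖Matrix.toEuclideanCLM (𝕜 := ℝ) Rᵀ‖ < 1 := by
    have h : Rᵀ = star R := by simp [Matrix.star_eq_conjTranspose]
    rw [h, map_star, ContinuousLinearMap.star_eq_adjoint, LinearIsometryEquiv.norm_map]
    exact hR
  have hx' : WithLp.toLp 2 x ≠ 0 := by simpa using hx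
  have h1 := (Matrix.toEuclideanCLM (𝕜 := ℝ) Rᵀ).le_opNorm (WithLp.toLp 2 x)
  have h2 : ‖Matrix.toEuclideanCLM (𝕜 := ℝ) Rᵀ (WithLp.toLp 2 x)‖ < ‖WithLp.toLp 2 x‖ :=
    h1.trans_lt (mul_lt_of_lt_one_left (norm_pos_iff.2 hx') hnorm)
  have h3 := pow_lt_pow_left₀ h2 (norm_nonneg _) two_ne_zero
  rw [← real_inner_self_eq_norm_sq, ← real_inner_self_eq_norm_sq, Matrix.toEuclideanCLM_toLp,
    EuclideanSpace.inner_toLp_toLp, EuclideanSpace.inner_toLp_toLp] at h3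
  simp only [star_trivial, Matrix.sub_mulVec, Matrix.one_mulVec, dotProduct_sub, sub_pos] at h3 ⊢
  rwa [← Matrix.mulVec_mulVec, Matrix.dotProduct_mulVec, ← Matrix.mulVec_transpose]

/-- The inverse of `[1 T; Tᵀ 1]`, one-sided. -/
theorem fromBlocks_one_mul_inv {T : Mat d} (hT : (1 - T * Tᵀ).PosDef) :
    fromBlocks 1 T Tᵀ 1 * fromBlocks (1 - T * Tᵀ)⁻¹ (-((1 - T * Tᵀ)⁻¹ * T))
      (-(Tᵀ * (1 - T * Tᵀ)⁻¹)) (1 + Tᵀ * (1 - T * Tᵀ)⁻¹ * T) = 1 := by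
  have h : (1 - T * Tᵀ)⁻¹ - T * Tᵀ * (1 - T * Tᵀ)⁻¹ = 1 := by
    have := Matrix.mul_nonsing_inv _ (isUnit_det hT)
    rwa [Matrix.sub_mul, Matrix.one_mul] at this
  rw [Matrix.fromBlocks_multiply, ← Matrix.fromBlocks_one]
  congr 1
  · simpa [← sub_eq_add_neg, Matrix.mul_assoc] using h
  · have := congrArg (· * T) h
    simp only [Matrix.sub_mul, Matrix.one_mul] at this
    simp only [Matrix.one_mul, Matrix.mul_add, Matrix.mul_one, ← Matrix.mul_assoc]
    rwa [neg_add_eq_zero, ← sub_eq_iff_eq_add]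
  · simp
  · simp [Matrix.mul_assoc]

/-- The Schur complement gives semidefiniteness; the explicit inverse upgrades it to definiteness.
-/
theorem posDef_fromBlocks_one {T : Mat d} (hT : (1 - T * Tᵀ).PosDef) :
    (fromBlocks 1 T Tᵀ 1 : BlockMat d).PosDef := by
  have hpsd : (fromBlocks 1 T Tᵀ 1 : BlockMat d).PosSemidef := by
    have : Invertible (1 : Mat d) := invertibleOne
    have := (Matrix.PosDef.fromBlocks₂₂ (1 : Mat d) T (D := (1 : Mat d)) Matrix.PosDef.one).2
      (by simpa using hT.posSemidef)
    simpa using this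
  exact hpsd.posDef_iff_isUnit.2 (IsUnit.of_mul_eq_one _ (fromBlocks_one_mul_inv hT))

theorem refCov_eq (A B T : Mat d) (hA : A.PosDef) (hB : B.PosDef) :
    refCov A B T = fromBlocks (CFC.sqrt A) 0 0 (CFC.sqrt B) * fromBlocks 1 T Tᵀ 1 *
      fromBlocks (CFC.sqrt A) 0 0 (CFC.sqrt B) := by
  simp [refCov, Matrix.fromBlocks_multiply, sqrt_mul_self hA, sqrt_mul_self hB]

theorem fromBlocks_diag_mul_inv {A B : Mat d} (hA : A.PosDef) (hB : B.PosDef) :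
    fromBlocks A 0 0 B * fromBlocks A⁻¹ 0 0 B⁻¹ = (1 : BlockMat d) := by
  simp [Matrix.fromBlocks_multiply, Matrix.mul_nonsing_inv _ (isUnit_det hA),
    Matrix.mul_nonsing_inv _ (isUnit_det hB)]

theorem posDef_refCov {A B T : Mat d} (hA : A.PosDef) (hB : B.PosDef)
    (hT : (1 - T * Tᵀ).PosDef) : (refCov A B T).PosDef := by
  have hu : IsUnit (fromBlocks (CFC.sqrt A) 0 0 (CFC.sqrt B) : BlockMat d) :=
    IsUnit.of_mul_eq_one _ (fromBlocks_diag_mul_inv (posDef_sqrt hA) (posDef_sqrt hB))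
  have := (posDef_fromBlocks_one hT).conjTranspose_mul_mul_same
    (Matrix.mulVec_injective_iff_isUnit.2 hu)
  rw [refCov_eq A B T hA hB]
  simpa [Matrix.fromBlocks_transpose, transpose_eq_self (posDef_sqrt hA),
    transpose_eq_self (posDef_sqrt hB)] using this

theorem inv_refCov_toBlocks₁₂ {A B T : Mat d} (hA : A.PosDef) (hB : B.PosDef)
    (hT : (1 - T * Tᵀ).PosDef) :
    (refCov A B T)⁻¹.toBlocks₁₂ =
      -((CFC.sqrt A)⁻¹ * ((1 - T * Tᵀ)⁻¹ * T) * (CFC.sqrt B)⁻¹) := by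
  rw [refCov_eq A B T hA hB, Matrix.mul_inv_rev, Matrix.mul_inv_rev,
    Matrix.inv_eq_right_inv (fromBlocks_one_mul_inv hT),
    Matrix.inv_eq_right_inv (fromBlocks_diag_mul_inv (posDef_sqrt hA) (posDef_sqrt hB))]
  simp [Matrix.fromBlocks_multiply, Matrix.mul_assoc]

theorem mul_inv_one_sub {R : Mat d} (hR : (1 - R * Rᵀ).PosDef) :
    R * (1 - Rᵀ * R)⁻¹ = (1 - R * Rᵀ)⁻¹ * R := by
  have h1 := isUnit_det hR
  -- Sylvester's determinant identity transfers invertibility from `1 - R Rᵀ`.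
  have h2 : IsUnit (1 - Rᵀ * R).det := by rwa [Matrix.det_one_sub_mul_comm]
  have h : (1 - R * Rᵀ) * R = R * (1 - Rᵀ * R) := by noncomm_ring
  calc R * (1 - Rᵀ * R)⁻¹
      = (1 - R * Rᵀ)⁻¹ * ((1 - R * Rᵀ) * R) * (1 - Rᵀ * R)⁻¹ := by
        rw [Matrix.nonsing_inv_mul_cancel_left _ _ h1]
    _ = (1 - R * Rᵀ)⁻¹ * R := by
        rw [h, Matrix.mul_assoc, Matrix.mul_nonsing_inv_cancel_right _ _ h2]

theorem Meps_refCov {A B R : Mat d} (hA : A.PosDef) (hB : B.PosDef)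
    (hR : (1 - R * Rᵀ).PosDef) (ε : ℝ) :
    Meps (refCov A B R) ε = (CFC.sqrt A)⁻¹ * Nmat A B R ε * (CFC.sqrt B)⁻¹ := by
  rw [Meps, Nmat, inv_refCov_toBlocks₁₂ hA hB hR, mul_inv_one_sub hR, Matrix.mul_add,
    Matrix.add_mul, Matrix.nonsing_inv_mul_cancel_left _ _ (isUnit_det (posDef_sqrt hA)),
    Matrix.mul_nonsing_inv _ (isUnit_det (posDef_sqrt hB))]
  simp [sub_neg_eq_add]

theorem isUnit_Nmat {A B R : Mat d} {ε : ℝ} (hA : A.PosDef) (hB : B.PosDef)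
    (hR : (1 - R * Rᵀ).PosDef) (h : IsUnit (Meps (refCov A B R) ε)) :
    IsUnit (Nmat A B R ε) := by
  have := ((posDef_sqrt hA).isUnit.mul h).mul (posDef_sqrt hB).isUnit
  rwa [Meps_refCov hA hB hR, Matrix.mul_assoc, Matrix.mul_assoc,
    Matrix.nonsing_inv_mul _ (isUnit_det (posDef_sqrt hB)), Matrix.mul_one,
    Matrix.mul_nonsing_inv_cancel_left _ _ (isUnit_det (posDef_sqrt hA))] at this

/-- `P = (N Nᵀ + ε²/4)^{1/2} + ε/2`. -/
noncomputable def shiftedSqrt (N : Mat d) (ε : ℝ) : Mat d :=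
  CFC.sqrt (N * Nᵀ + (ε ^ 2 / 4) • (1 : Mat d)) + (ε / 2) • (1 : Mat d)

theorem shiftedSqrt_posDef (N : Mat d) {ε : ℝ} (hε : 0 < ε) : (shiftedSqrt N ε).PosDef := by
  refine Matrix.PosDef.posSemidef_add (CFC.sqrt_nonneg _).posSemidef ?_
  exact Matrix.PosDef.one.smul (by positivity)

theorem shiftedSqrt_mul_sub (N : Mat d) (ε : ℝ) :
    shiftedSqrt N ε * (CFC.sqrt (N * Nᵀ + (ε ^ 2 / 4) • (1 : Mat d)) - (ε / 2) • (1 : Mat d)) =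
      N * Nᵀ := by
  have hpsd : (N * Nᵀ + (ε ^ 2 / 4) • (1 : Mat d)).PosSemidef := by
    have h1 : (N * Nᵀ).PosSemidef := by simpa using Matrix.posSemidef_self_mul_conjTranspose N
    exact h1.add (Matrix.PosSemidef.one.smul (by positivity))
  have := CFC.sqrt_mul_sqrt_self _ hpsd.nonneg
  rw [shiftedSqrt, Matrix.add_mul, Matrix.mul_sub, Matrix.mul_sub, this]
  simp only [Matrix.mul_smul, Matrix.smul_mul, Matrix.mul_one, Matrix.one_mul]
  module

theorem mul_transpose_eq_shiftedSqrt (N : Mat d) (ε : ℝ) :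
    N * Nᵀ = shiftedSqrt N ε * shiftedSqrt N ε - ε • shiftedSqrt N ε := by
  rw [← shiftedSqrt_mul_sub N ε]
  simp only [shiftedSqrt, Matrix.mul_add, Matrix.mul_sub, Matrix.mul_smul, Matrix.mul_one]
  module

/-- Left multiplication by `P` turns the bracket into `N Nᵀ`, and `Nᵀ` then cancels. This converts
the closed form of `Ceps` into one in which no inverse of `N` appears. -/
theorem sub_mul_inv_eq {N : Mat d} {ε : ℝ} (hε : 0 < ε) (hN : IsUnit N) :
    (CFC.sqrt (N * Nᵀ + (ε ^ 2 / 4) • (1 : Mat d)) - (ε / 2) • (1 : Mat d)) * (Nᵀ)⁻¹ =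
      (shiftedSqrt N ε)⁻¹ * N := by
  have hP := isUnit_det (shiftedSqrt_posDef N hε)
  have hN' : IsUnit (Nᵀ).det := by
    rw [Matrix.det_transpose]; exact (Matrix.isUnit_iff_isUnit_det N).1 hN
  rw [← Matrix.nonsing_inv_mul_cancel_left _ (CFC.sqrt _ - _) hP, shiftedSqrt_mul_sub,
    Matrix.mul_assoc, Matrix.mul_nonsing_inv_cancel_right _ _ hN']

/-- The correlation matrix of the optimal coupling. -/
noncomputable def optCorr (N : Mat d) (ε : ℝ) : Mat d := (shiftedSqrt N ε)⁻¹ * N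

/-- By `N Nᵀ = P² - εP`, conjugation by `P⁻¹` gives `T Tᵀ = 1 - ε P⁻¹`. -/
theorem one_sub_optCorr (N : Mat d) {ε : ℝ} (hε : 0 < ε) :
    1 - optCorr N ε * (optCorr N ε)ᵀ = ε • (shiftedSqrt N ε)⁻¹ := by
  have hP := shiftedSqrt_posDef N hε
  rw [optCorr, Matrix.transpose_mul, transpose_eq_self hP.inv, Matrix.mul_assoc,
    ← Matrix.mul_assoc N, mul_transpose_eq_shiftedSqrt N ε, Matrix.sub_mul,
    Matrix.mul_nonsing_inv_cancel_right _ _ (isUnit_det hP), Matrix.mul_sub,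
    Matrix.nonsing_inv_mul _ (isUnit_det hP), Matrix.smul_mul,
    Matrix.mul_nonsing_inv _ (isUnit_det hP)]
  simp

theorem posDef_one_sub_optCorr (N : Mat d) {ε : ℝ} (hε : 0 < ε) :
    (1 - optCorr N ε * (optCorr N ε)ᵀ).PosDef := by
  rw [one_sub_optCorr N hε]
  exact (shiftedSqrt_posDef N hε).inv.smul hε

theorem inv_one_sub_optCorr_mul (N : Mat d) {ε : ℝ} (hε : 0 < ε) :
    (1 - optCorr N ε * (optCorr N ε)ᵀ)⁻¹ * optCorr N ε = ε⁻¹ • N := by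
  have hP := isUnit_det (shiftedSqrt_posDef N hε)
  have h : (ε • (shiftedSqrt N ε)⁻¹)⁻¹ = ε⁻¹ • shiftedSqrt N ε := by
    refine Matrix.inv_eq_right_inv ?_
    rw [Matrix.smul_mul, Matrix.mul_smul, Matrix.nonsing_inv_mul _ hP, smul_smul,
      mul_inv_cancel₀ hε.ne', one_smul]
  rw [one_sub_optCorr N hε, h, optCorr, Matrix.smul_mul, Matrix.mul_nonsing_inv_cancel_left _ _ hP]

theorem jointCov_Ceps {A B R : Mat d} {ε : ℝ} (hA : A.PosDef) (hB : B.PosDef) (hε : 0 < ε)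
    (hN : IsUnit (Nmat A B R ε)) :
    jointCov A B (Ceps A B R ε) = refCov A B (optCorr (Nmat A B R ε) ε) := by
  have h : Ceps A B R ε = CFC.sqrt A * optCorr (Nmat A B R ε) ε * CFC.sqrt B := by
    rw [Ceps, Matrix.mul_assoc (CFC.sqrt A), sub_mul_inv_eq hε hN, optCorr]
  rw [jointCov, refCov, h, Matrix.transpose_mul, Matrix.transpose_mul,
    transpose_eq_self (posDef_sqrt hA), transpose_eq_self (posDef_sqrt hB), Matrix.mul_assoc,
    Matrix.mul_assoc (CFC.sqrt B)]

theorem posDef_jointCov_Ceps {A B R : Mat d} {ε : ℝ} (hA : A.PosDef) (hB : B.PosDef) (hε : 0 < ε)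
    (hN : IsUnit (Nmat A B R ε)) : (jointCov A B (Ceps A B R ε)).PosDef := by
  rw [jointCov_Ceps hA hB hε hN]
  exact posDef_refCov hA hB (posDef_one_sub_optCorr _ hε)

/-- This is the optimality condition: it makes the cross terms of the cost and of the log-density
cancel. -/
theorem inv_jointCov_Ceps_toBlocks₁₂ {A B R : Mat d} {ε : ℝ} (hA : A.PosDef) (hB : B.PosDef)
    (hR : (1 - R * Rᵀ).PosDef) (hε : 0 < ε) (hN : IsUnit (Nmat A B R ε)) :
    (refCov A B R)⁻¹.toBlocks₁₂ - (jointCov A B (Ceps A B R ε))⁻¹.toBlocks₁₂ =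
      ε⁻¹ • (1 : Mat d) := by
  have h := Meps_refCov hA hB hR ε
  rw [Meps] at h
  rw [jointCov_Ceps hA hB hε hN, inv_refCov_toBlocks₁₂ hA hB (posDef_one_sub_optCorr _ hε),
    inv_one_sub_optCorr_mul _ hε, Matrix.mul_smul, Matrix.smul_mul, ← h, smul_sub, smul_smul,
    inv_mul_cancel₀ hε.ne', one_smul]
  abel

end Algebra

/-! ### Gaussian densities as exponential tilts of Lebesgue measure -/

section Density

variable {ι : Type*} [Fintype ι]

theorem integrable_exp_neg_sq_norm :
    Integrable (fun x : EuclideanSpace ℝ ι => Real.exp (-(‖x‖ ^ 2) / 2)) := by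
  have h := (GaussianFourier.integrable_cexp_neg_mul_sq_norm_add (V := EuclideanSpace ℝ ι)
    (b := (1 / 2 : ℂ)) (by norm_num) 0 0).norm
  refine h.congr (Filter.Eventually.of_forall fun x => ?_)
  simp only [zero_mul, add_zero, Complex.norm_exp]
  congr 1
  rw [show -(1 / 2 : ℂ) * (‖x‖ : ℂ) ^ 2 = ((-(‖x‖ ^ 2) / 2 : ℝ) : ℂ) by push_cast; ring,
    Complex.ofReal_re]

/-- The standard Gaussian measure has density proportional to `exp (-‖x‖² / 2)`. -/
theorem stdGaussian_eq_tilted :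
    stdGaussian (EuclideanSpace ℝ ι) =
      (volume : Measure (EuclideanSpace ℝ ι)).tilted fun x => -(‖x‖ ^ 2) / 2 := by
  have := isProbabilityMeasure_tilted (integrable_exp_neg_sq_norm (ι := ι))
  refine Measure.ext_of_charFun (funext fun t => ?_)
  rw [charFun_stdGaussian, charFun_apply, integral_tilted]
  have hb : (0 : ℝ) < (1 / 2 : ℂ).re := by norm_num
  -- The linear coefficient `I` gives the Fourier transform; the coefficient-free integral below
  -- supplies its normalisation.
  have h1 := GaussianFourier.integral_cexp_neg_mul_sq_norm_add hb Complex.I t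
  have h0 := GaussianFourier.integral_cexp_neg_mul_sq_norm (V := EuclideanSpace ℝ ι) hb
  have hZ : ((∫ x : EuclideanSpace ℝ ι, Real.exp (-(‖x‖ ^ 2) / 2) : ℝ) : ℂ) =
      ∫ x : EuclideanSpace ℝ ι, Complex.exp (-(1 / 2) * ‖x‖ ^ 2) := by
    rw [← integral_complex_ofReal]
    congr with x
    push_cast
    congr 1
    ring
  have hZ0 : ((∫ x : EuclideanSpace ℝ ι, Real.exp (-(‖x‖ ^ 2) / 2) : ℝ) : ℂ) ≠ 0 :=
    Complex.ofReal_ne_zero.2 (integral_exp_pos integrable_exp_neg_sq_norm).ne'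
  have h2 : ∀ x : EuclideanSpace ℝ ι,
      (Real.exp (-(‖x‖ ^ 2) / 2) / ∫ x : EuclideanSpace ℝ ι, Real.exp (-(‖x‖ ^ 2) / 2)) •
        Complex.exp (inner ℝ x t * Complex.I) =
      ((∫ x : EuclideanSpace ℝ ι, Real.exp (-(‖x‖ ^ 2) / 2) : ℝ) : ℂ)⁻¹ *
        Complex.exp (-(1 / 2) * ‖x‖ ^ 2 + Complex.I * inner ℝ t x) := by
    intro x
    rw [Complex.real_smul, Complex.exp_add, real_inner_comm]
    push_cast
    rw [show -(‖x‖ : ℂ) ^ 2 / 2 = -(1 / 2) * (‖x‖ : ℂ) ^ 2 by ring, mul_comm Complex.I]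
    ring
  simp_rw [h2]
  rw [integral_const_mul, h1, ← h0, ← hZ, inv_mul_cancel_left₀ hZ0, Complex.I_sq]
  congr 1
  ring

theorem map_tilted_comp {α β : Type*} [MeasurableSpace α] [MeasurableSpace β] (μ : Measure α)
    {g : α → β} (hg : Measurable g) {f : β → ℝ} (hf : Measurable f) :
    (μ.tilted (f ∘ g)).map g = (μ.map g).tilted f := by
  ext s hs
  have hint : ∫ x, Real.exp (f x) ∂(μ.map g) = ∫ x, Real.exp ((f ∘ g) x) ∂μ :=
    integral_map hg.aemeasurable (by fun_prop)
  rw [Measure.map_apply hg hs, tilted_apply' _ _ hs, tilted_apply' _ _ (hg hs), hint,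
    setLIntegral_map hs (by fun_prop) hg]
  rfl

/-- Tilting normalises, so the Jacobian factor from pushing Lebesgue measure through `S^{1/2}`
disappears. -/
theorem tilted_smul_measure {α : Type*} [MeasurableSpace α] (μ : Measure α) (f : α → ℝ)
    {c : ℝ≥0∞} (hc : c ≠ 0) (hc' : c ≠ ∞) : (c • μ).tilted f = μ.tilted f := by
  have hc0 : 0 < c.toReal := ENNReal.toReal_pos hc hc'
  ext s hs
  rw [tilted_apply' _ _ hs, tilted_apply' _ _ hs, Measure.restrict_smul, lintegral_smul_measure,
    integral_smul_measure, smul_eq_mul, ← lintegral_const_mul' _ _ hc']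
  refine lintegral_congr fun x => ?_
  nth_rw 1 [← ENNReal.ofReal_toReal hc']
  rw [← ENNReal.ofReal_mul hc0.le]
  congr 1
  rw [smul_eq_mul, mul_div_assoc', mul_div_mul_left _ _ hc0.ne']

/-- The quadratic form `z ↦ zᵀ Q z`. -/
noncomputable def quad (Q : Matrix ι ι ℝ) (z : EuclideanSpace ℝ ι) : ℝ := z ⬝ᵥ Q *ᵥ z

@[fun_prop]
theorem continuous_quad (Q : Matrix ι ι ℝ) : Continuous (quad Q) := by
  unfold quad
  fun_prop

variable [DecidableEq ι]

theorem quad_inv_sqrt {S : Matrix ι ι ℝ} (hS : S.PosDef) (x : EuclideanSpace ℝ ι) :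
    quad S⁻¹ (Matrix.toEuclideanCLM (𝕜 := ℝ) (CFC.sqrt S) x) = ‖x‖ ^ 2 := by
  have hs := isUnit_det (posDef_sqrt hS)
  have h : CFC.sqrt S * (S⁻¹ * CFC.sqrt S) = 1 := by
    nth_rw 2 [← sqrt_mul_self hS]
    rw [Matrix.mul_inv_rev, Matrix.nonsing_inv_mul_cancel_right _ _ hs, Matrix.mul_nonsing_inv _ hs]
  rw [quad, Matrix.ofLp_toEuclideanCLM, Matrix.mulVec_mulVec, Matrix.dotProduct_mulVec,
    Matrix.vecMul_mulVec, transpose_eq_self (posDef_sqrt hS), h, Matrix.vecMul_one, EuclideanSpace.real_norm_sq_eq, dotProduct]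
  simp [sq]

theorem map_toEuclideanCLM_volume {M : Matrix ι ι ℝ} (hM : M.det ≠ 0) :
    (volume : Measure (EuclideanSpace ℝ ι)).map (Matrix.toEuclideanCLM (𝕜 := ℝ) M) =
      ENNReal.ofReal |M.det⁻¹| • volume := by
  have hdet : LinearMap.det (Matrix.toEuclideanLin M) = M.det := by
    rw [Matrix.toEuclideanLin_eq_toLin_orthonormal, LinearMap.det_toLin]
  have := Measure.map_linearMap_addHaar_eq_smul_addHaar
    (volume : Measure (EuclideanSpace ℝ ι)) (f := Matrix.toEuclideanLin M) (by rwa [hdet])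
  rwa [hdet] at this

/-- A nondegenerate centered Gaussian measure has density proportional to
`exp (-zᵀ S⁻¹ z / 2)`. -/
theorem multivariateGaussian_eq_tilted {S : Matrix ι ι ℝ} (hS : S.PosDef) :
    multivariateGaussian 0 S =
      (volume : Measure (EuclideanSpace ℝ ι)).tilted fun z => -quad S⁻¹ z / 2 := by
  have hs := (isUnit_det (posDef_sqrt hS)).ne_zero
  have hc : (fun x : EuclideanSpace ℝ ι => -(‖x‖ ^ 2) / 2) =
      (fun z => -quad S⁻¹ z / 2) ∘ Matrix.toEuclideanCLM (𝕜 := ℝ) (CFC.sqrt S) := by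
    ext x
    simp [quad_inv_sqrt hS]
  simp only [multivariateGaussian, zero_add]
  rw [stdGaussian_eq_tilted, hc]
  refine (map_tilted_comp _ (by fun_prop) (by fun_prop)).trans ?_
  rw [map_toEuclideanCLM_volume hs]
  exact tilted_smul_measure _ _ (by simpa using hs) ENNReal.ofReal_ne_top

/-- Change of variables by `S^{1/2}`. The standard Gaussian integral is left unevaluated, since only
ratios are needed. -/
theorem integral_exp_neg_quad {S : Matrix ι ι ℝ} (hS : S.PosDef) :
    ∫ z : EuclideanSpace ℝ ι, Real.exp (-quad S⁻¹ z / 2) =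
      √S.det * ∫ x : EuclideanSpace ℝ ι, Real.exp (-(‖x‖ ^ 2) / 2) := by
  have hs := isUnit_det (posDef_sqrt hS)
  have hpos : 0 < (CFC.sqrt S).det := (posDef_sqrt hS).det_pos
  have hsq : √S.det = (CFC.sqrt S).det := by
    rw [← sqrt_mul_self hS, Matrix.det_mul, sqrt_mul_self hS, Real.sqrt_mul_self hpos.le]
  have hm := map_toEuclideanCLM_volume hs.ne_zero
  have : ∫ x : EuclideanSpace ℝ ι, Real.exp (-(‖x‖ ^ 2) / 2) =
      ∫ z, Real.exp (-quad S⁻¹ z / 2) ∂(volume : Measure (EuclideanSpace ℝ ι)).map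
        (Matrix.toEuclideanCLM (𝕜 := ℝ) (CFC.sqrt S)) := by
    rw [integral_map (by fun_prop) (by fun_prop)]
    simp_rw [quad_inv_sqrt hS]
  rw [this, hm, integral_smul_measure, ENNReal.toReal_ofReal (abs_nonneg _), hsq,
    abs_of_pos (inv_pos.2 hpos), smul_eq_mul, mul_inv_cancel_left₀ hpos.ne']

theorem integrable_exp_neg_quad {S : Matrix ι ι ℝ} (hS : S.PosDef) :
    Integrable fun z : EuclideanSpace ℝ ι => Real.exp (-quad S⁻¹ z / 2) := by
  -- A non-integrable function has integral `0` by convention, whereas the computed value is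
  -- positive.
  by_contra h
  have h1 := integral_exp_neg_quad hS
  rw [integral_undef h] at h1
  have h2 := integral_exp_pos (integrable_exp_neg_sq_norm (ι := ι))
  have h3 := Real.sqrt_pos.2 hS.det_pos
  exact (mul_pos h3 h2).ne h1

theorem multivariateGaussian_tilted {S S' : Matrix ι ι ℝ} (hS : S.PosDef) (hS' : S'.PosDef) :
    multivariateGaussian 0 S' =
      (multivariateGaussian 0 S).tilted fun z => quad (S⁻¹ - S'⁻¹) z / 2 := by
  rw [multivariateGaussian_eq_tilted hS, tilted_tilted (integrable_exp_neg_quad hS),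
    multivariateGaussian_eq_tilted hS']
  congr with z
  simp only [Pi.add_apply, quad, Matrix.sub_mulVec, dotProduct_sub]
  ring

theorem integral_exp_quad_multivariateGaussian {S S' : Matrix ι ι ℝ} (hS : S.PosDef)
    (hS' : S'.PosDef) :
    ∫ z, Real.exp (quad (S⁻¹ - S'⁻¹) z / 2) ∂(multivariateGaussian 0 S) =
      √S'.det / √S.det := by
  have h2 := integral_exp_pos (integrable_exp_neg_sq_norm (ι := ι))
  rw [multivariateGaussian_eq_tilted hS, integral_exp_tilted]
  have : ∀ z : EuclideanSpace ℝ ι, ((fun z => -quad S⁻¹ z / 2) +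
      fun z => quad (S⁻¹ - S'⁻¹) z / 2) z = -quad S'⁻¹ z / 2 := fun z => by
    simp only [Pi.add_apply, quad, Matrix.sub_mulVec, dotProduct_sub]
    ring
  simp_rw [this]
  rw [integral_exp_neg_quad hS, integral_exp_neg_quad hS', mul_div_mul_right _ _ h2.ne']

end Density

/-! ### Relative entropy under a change of reference measure -/

section Entropy

variable {α : Type*} [MeasurableSpace α] {π ν : Measure α} [IsProbabilityMeasure π]
  [IsProbabilityMeasure ν] {h : α → ℝ}

/-- Tilting preserves the null sets and changes the log-likelihood ratio by `h` and a constant, both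
`π`-integrable. -/
theorem klDiv_ne_top_iff_tilted (hν : Integrable (fun x => Real.exp (h x)) ν)
    (hπ : Integrable h π) : klDiv π ν ≠ ∞ ↔ klDiv π (ν.tilted h) ≠ ∞ := by
  rw [klDiv_ne_top_iff, klDiv_ne_top_iff]
  have hac : π ≪ ν ↔ π ≪ ν.tilted h :=
    ⟨fun H => H.trans (absolutelyContinuous_tilted hν),
      fun H => H.trans (tilted_absolutelyContinuous ν h)⟩
  rw [← hac]
  refine and_congr_right fun H => ?_
  refine ⟨fun hi => integrable_llr_tilted_right H hπ hi hν, fun hi => ?_⟩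
  refine ((hi.add hπ).sub (integrable_const (Real.log (∫ z, Real.exp (h z) ∂ν)))).congr ?_
  filter_upwards [llr_tilted_right H hν] with x hx
  simp only [Pi.sub_apply, Pi.add_apply, hx]
  ring

theorem toReal_klDiv_eq_tilted (hν : Integrable (fun x => Real.exp (h x)) ν)
    (hπ : Integrable h π) (hfin : klDiv π ν ≠ ∞) :
    (klDiv π ν).toReal = (klDiv π (ν.tilted h)).toReal + ∫ x, h x ∂π -
      Real.log (∫ x, Real.exp (h x) ∂ν) := by
  have := isProbabilityMeasure_tilted hν
  obtain ⟨hac, hi⟩ := klDiv_ne_top_iff.1 hfin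
  rw [toReal_klDiv_of_measure_eq hac (by simp),
    toReal_klDiv_of_measure_eq (hac.trans (absolutelyContinuous_tilted hν)) (by simp),
    integral_llr_tilted_right hac hπ hν hi]
  ring

end Entropy

/-! ### Gaussian measures on the product space and their marginals -/

section Split

variable {d : ℕ}

/-- The inverse of `split`. -/
noncomputable def unsplit (p : Euc d × Euc d) : EuclideanSpace ℝ (Fin d ⊕ Fin d) :=
  WithLp.toLp 2 (Sum.elim p.1 p.2)

@[simp]
theorem unsplit_split (z : EuclideanSpace ℝ (Fin d ⊕ Fin d)) : unsplit (split z) = z := by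
  ext i
  cases i <;> rfl

theorem continuous_split : Continuous (split (d := d)) := by
  unfold split
  fun_prop

theorem continuous_unsplit : Continuous (unsplit (d := d)) := by
  unfold unsplit
  refine (PiLp.continuous_toLp 2 _).comp (continuous_pi fun i => ?_)
  cases i <;> simp only [Sum.elim_inl, Sum.elim_inr] <;> fun_prop

theorem norm_sq_unsplit (p : Euc d × Euc d) : ‖unsplit p‖ ^ 2 = ‖p.1‖ ^ 2 + ‖p.2‖ ^ 2 := by
  simp [EuclideanSpace.real_norm_sq_eq, unsplit]

theorem inner_unsplit (z : EuclideanSpace ℝ (Fin d ⊕ Fin d)) (p : Euc d × Euc d) :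
    inner ℝ z (unsplit p) = inner ℝ (split z).1 p.1 + inner ℝ (split z).2 p.2 := by
  simp [PiLp.inner_apply, unsplit, split]

theorem quad_unsplit (Q : BlockMat d) (p : Euc d × Euc d) :
    quad Q (unsplit p) = quad Q.toBlocks₁₁ p.1 + p.1 ⬝ᵥ Q.toBlocks₁₂ *ᵥ p.2 +
      (p.2 ⬝ᵥ Q.toBlocks₂₁ *ᵥ p.1 + quad Q.toBlocks₂₂ p.2) := by
  nth_rw 1 [← Matrix.fromBlocks_toBlocks Q]
  simp [quad, unsplit, Matrix.fromBlocks_mulVec, Function.comp_def, dotProduct_add]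

theorem abs_quad_le {ι : Type*} [Fintype ι] [DecidableEq ι] (Q : Matrix ι ι ℝ)
    (z : EuclideanSpace ℝ ι) :
    |quad Q z| ≤ ‖Matrix.toEuclideanCLM (𝕜 := ℝ) Q‖ * ‖z‖ ^ 2 := by
  rw [quad, ← Matrix.inner_toEuclideanCLM]
  calc _ ≤ ‖z‖ * ‖Matrix.toEuclideanCLM (𝕜 := ℝ) Q z‖ := abs_real_inner_le_norm _ _
    _ ≤ ‖z‖ * (‖Matrix.toEuclideanCLM (𝕜 := ℝ) Q‖ * ‖z‖) := by
        gcongr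
        exact ContinuousLinearMap.le_opNorm _ _
    _ = _ := by ring

instance (S : BlockMat d) : IsProbabilityMeasure (gaussianProd S) :=
  Measure.isProbabilityMeasure_map continuous_split.measurable.aemeasurable

/-- Here `unsplit p` is the image of `t` under the adjoint of `f ∘ split`; both marginals follow
from this one computation. -/
theorem charFun_map_split {S : BlockMat d} (hS : S.PosSemidef) {f : Euc d × Euc d → Euc d}
    (hf : Measurable f) (t : Euc d) (p : Euc d × Euc d)
    (hp : ∀ z, inner ℝ (f (split z)) t = inner ℝ z (unsplit p)) :
    charFun ((gaussianProd S).map f) t = Complex.exp (-((quad S (unsplit p) : ℝ) : ℂ) / 2) := by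
  have hm := continuous_split (d := d).measurable
  rw [gaussianProd, Measure.map_map hf hm, charFun_apply, integral_map (hf.comp hm).aemeasurable
    (by fun_prop)]
  simp only [Function.comp_apply, hp]
  rw [← charFun_apply, charFun_multivariateGaussian hS]
  simp [quad, neg_div]

theorem map_fst_gaussianProd {A B C : Mat d} (hA : A.PosSemidef)
    (h : (jointCov A B C).PosSemidef) :
    (gaussianProd (jointCov A B C)).map Prod.fst = gaussian A := by
  have := Measure.isProbabilityMeasure_map (μ := gaussianProd (jointCov A B C))
    (f := Prod.fst) (by fun_prop)
  unfold gaussian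
  refine Measure.ext_of_charFun (funext fun t => ?_)
  rw [charFun_map_split h measurable_fst t (t, 0) (fun z => by simp [inner_unsplit]),
    charFun_multivariateGaussian hA, quad_unsplit]
  simp [jointCov, quad, neg_div]

theorem map_snd_gaussianProd {A B C : Mat d} (hB : B.PosSemidef)
    (h : (jointCov A B C).PosSemidef) :
    (gaussianProd (jointCov A B C)).map Prod.snd = gaussian B := by
  have := Measure.isProbabilityMeasure_map (μ := gaussianProd (jointCov A B C))
    (f := Prod.snd) (by fun_prop)
  unfold gaussian
  refine Measure.ext_of_charFun (funext fun t => ?_)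
  rw [charFun_map_split h measurable_snd t (0, t) (fun z => by simp [inner_unsplit]),
    charFun_multivariateGaussian hB, quad_unsplit]
  simp [jointCov, quad, neg_div]

theorem gaussianProd_mem_couplings {A B C : Mat d} (hA : A.PosSemidef) (hB : B.PosSemidef)
    (h : (jointCov A B C).PosSemidef) :
    gaussianProd (jointCov A B C) ∈ couplings (gaussian A) (gaussian B) :=
  ⟨inferInstance, map_fst_gaussianProd hA h, map_snd_gaussianProd hB h⟩

/-- The log-density of `N(S')` with respect to `N(S)`, up to an additive constant. -/
noncomputable def logRatio (S S' : BlockMat d) (p : Euc d × Euc d) : ℝ :=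
  quad (S⁻¹ - S'⁻¹) (unsplit p) / 2

theorem continuous_logRatio (S S' : BlockMat d) : Continuous (logRatio S S') :=
  ((continuous_quad _).comp continuous_unsplit).div_const _

theorem integral_exp_logRatio {S S' : BlockMat d} (hS : S.PosDef) (hS' : S'.PosDef) :
    ∫ p, Real.exp (logRatio S S' p) ∂(gaussianProd S) = √S'.det / √S.det := by
  have := continuous_logRatio S S'
  rw [gaussianProd, integral_map continuous_split.measurable.aemeasurable (by fun_prop)]
  simp only [logRatio, unsplit_split]
  exact integral_exp_quad_multivariateGaussian hS hS'

theorem integrable_exp_logRatio {S S' : BlockMat d} (hS : S.PosDef) (hS' : S'.PosDef) :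
    Integrable (fun p => Real.exp (logRatio S S' p)) (gaussianProd S) := by
  by_contra h
  have h1 := integral_exp_logRatio hS hS'
  rw [integral_undef h] at h1
  exact (div_pos (Real.sqrt_pos.2 hS'.det_pos) (Real.sqrt_pos.2 hS.det_pos)).ne h1

theorem gaussianProd_eq_tilted {S S' : BlockMat d} (hS : S.PosDef) (hS' : S'.PosDef) :
    gaussianProd S' = (gaussianProd S).tilted (logRatio S S') := by
  rw [gaussianProd, gaussianProd,
    ← map_tilted_comp _ continuous_split.measurable (continuous_logRatio S S').measurable,
    multivariateGaussian_tilted hS hS']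
  congr with z
  simp [logRatio]

theorem integrable_norm_sq_gaussian (A : Mat d) : Integrable (fun x => ‖x‖ ^ 2) (gaussian A) :=
  (IsGaussian.memLp_two_id (μ := multivariateGaussian 0 A)).integrable_norm_pow two_ne_zero

theorem integrable_quad_gaussian (A Q : Mat d) : Integrable (quad Q) (gaussian A) :=
  ((integrable_norm_sq_gaussian A).const_mul _).mono' (continuous_quad Q).aestronglyMeasurable
    (.of_forall fun z => abs_quad_le Q z)

end Split

/-! ### Reduction of the objective to a relative entropy -/

section Coupling

variable {d : ℕ} {A B : Mat d} {π : Measure (Euc d × Euc d)}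

theorem integrable_comp_fst (hπ : π ∈ couplings (gaussian A) (gaussian B)) {f : Euc d → ℝ}
    (hf : Integrable f (gaussian A)) : Integrable (fun p => f p.1) π := by
  rw [← hπ.2.1] at hf
  exact hf.comp_measurable measurable_fst

theorem integrable_comp_snd (hπ : π ∈ couplings (gaussian A) (gaussian B)) {f : Euc d → ℝ}
    (hf : Integrable f (gaussian B)) : Integrable (fun p => f p.2) π := by
  rw [← hπ.2.2] at hf
  exact hf.comp_measurable measurable_snd

theorem integral_comp_fst (hπ : π ∈ couplings (gaussian A) (gaussian B)) {f : Euc d → ℝ}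
    (hf : Continuous f) : ∫ p, f p.1 ∂π = ∫ x, f x ∂(gaussian A) := by
  rw [← hπ.2.1, integral_map measurable_fst.aemeasurable hf.aestronglyMeasurable]

theorem integral_comp_snd (hπ : π ∈ couplings (gaussian A) (gaussian B)) {f : Euc d → ℝ}
    (hf : Continuous f) : ∫ p, f p.2 ∂π = ∫ x, f x ∂(gaussian B) := by
  rw [← hπ.2.2, integral_map measurable_snd.aemeasurable hf.aestronglyMeasurable]

theorem integrable_norm_sq_add (hπ : π ∈ couplings (gaussian A) (gaussian B)) :
    Integrable (fun p => ‖p.1‖ ^ 2 + ‖p.2‖ ^ 2) π :=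
  (integrable_comp_fst hπ (integrable_norm_sq_gaussian A)).add
    (integrable_comp_snd hπ (integrable_norm_sq_gaussian B))

theorem integrable_norm_sub_sq (hπ : π ∈ couplings (gaussian A) (gaussian B)) :
    Integrable (fun p => ‖p.1 - p.2‖ ^ 2) π := by
  refine ((integrable_norm_sq_add hπ).const_mul 2).mono' (by fun_prop) (.of_forall fun p => ?_)
  -- This bounds `‖x - y‖²` by `2(‖x‖² + ‖y‖²)`.
  have := parallelogram_law_with_norm ℝ p.1 p.2
  rw [Real.norm_of_nonneg (by positivity)]
  nlinarith [sq_nonneg ‖p.1 + p.2‖]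

theorem integrable_logRatio (hπ : π ∈ couplings (gaussian A) (gaussian B)) (S S' : BlockMat d) :
    Integrable (logRatio S S') π := by
  refine (((integrable_norm_sq_add hπ).const_mul
    ‖Matrix.toEuclideanCLM (𝕜 := ℝ) (S⁻¹ - S'⁻¹)‖).div_const 2).mono'
    (continuous_logRatio S S').aestronglyMeasurable (.of_forall fun p => ?_)
  have := abs_quad_le (S⁻¹ - S'⁻¹) (unsplit p)
  rw [norm_sq_unsplit] at this
  rw [logRatio, Real.norm_eq_abs, abs_div, abs_two]
  gcongr

/-- The two off-diagonal blocks contribute `2⟨x, y⟩` in total, exactly cancelling the cross term of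
`‖x - y‖²`. -/
theorem norm_sub_sq_add_logRatio {S S' : BlockMat d} {ε : ℝ} (hS : S.PosDef) (hS' : S'.PosDef)
    (hε : 0 < ε) (h : S⁻¹.toBlocks₁₂ - S'⁻¹.toBlocks₁₂ = ε⁻¹ • (1 : Mat d))
    (p : Euc d × Euc d) :
    ‖p.1 - p.2‖ ^ 2 + 2 * ε * logRatio S S' p =
      (‖p.1‖ ^ 2 + ε * quad (S⁻¹ - S'⁻¹).toBlocks₁₁ p.1) +
        (‖p.2‖ ^ 2 + ε * quad (S⁻¹ - S'⁻¹).toBlocks₂₂ p.2) := by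
  have h12 : (S⁻¹ - S'⁻¹).toBlocks₁₂ = ε⁻¹ • (1 : Mat d) := h
  have h21 : (S⁻¹ - S'⁻¹).toBlocks₂₁ = ε⁻¹ • (1 : Mat d) := by
    have hsymm : (S⁻¹ - S'⁻¹)ᵀ = S⁻¹ - S'⁻¹ := by
      rw [Matrix.transpose_sub, transpose_eq_self hS.inv, transpose_eq_self hS'.inv]
    have : (S⁻¹ - S'⁻¹).toBlocks₂₁ = ((S⁻¹ - S'⁻¹)ᵀ.toBlocks₁₂)ᵀ := rfl
    rw [this, hsymm, h12]
    simp
  have hin : (p.1 : Fin d → ℝ) ⬝ᵥ p.2 = inner ℝ p.1 p.2 := by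
    simp [PiLp.inner_apply, dotProduct, mul_comm]
  have hin' : (p.2 : Fin d → ℝ) ⬝ᵥ p.1 = inner ℝ p.1 p.2 := by rw [dotProduct_comm, hin]
  rw [logRatio, quad_unsplit, h12, h21, norm_sub_sq_real]
  simp only [Matrix.smul_mulVec, Matrix.one_mulVec, dotProduct_smul, smul_eq_mul,
    hin, hin']
  field_simp
  ring

/-- The value of the entropic transport problem, when `N(S')` is the optimal coupling. -/
noncomputable def optValue (A B : Mat d) (S S' : BlockMat d) (ε : ℝ) : ℝ :=
  ∫ x, (‖x‖ ^ 2 + ε * quad (S⁻¹ - S'⁻¹).toBlocks₁₁ x) ∂(gaussian A) +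
    ∫ y, (‖y‖ ^ 2 + ε * quad (S⁻¹ - S'⁻¹).toBlocks₂₂ y) ∂(gaussian B) -
    2 * ε * Real.log (√S'.det / √S.det)

theorem integral_norm_sub_sq_add_logRatio {S S' : BlockMat d} {ε : ℝ} (hS : S.PosDef)
    (hS' : S'.PosDef) (hε : 0 < ε)
    (h : S⁻¹.toBlocks₁₂ - S'⁻¹.toBlocks₁₂ = ε⁻¹ • (1 : Mat d))
    (hπ : π ∈ couplings (gaussian A) (gaussian B)) :
    ∫ p, ‖p.1 - p.2‖ ^ 2 ∂π + 2 * ε * (∫ p, logRatio S S' p ∂π - Real.log (√S'.det / √S.det)) =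
      optValue A B S S' ε := by
  have hi (A' Q : Mat d) : Integrable (fun x => ‖x‖ ^ 2 + ε * quad Q x) (gaussian A') :=
    (integrable_norm_sq_gaussian A').add ((integrable_quad_gaussian A' Q).const_mul ε)
  have hc (Q : Mat d) : Continuous fun x : Euc d => ‖x‖ ^ 2 + ε * quad Q x := by fun_prop
  rw [mul_sub, ← integral_const_mul, ← add_sub_assoc,
    ← integral_add (integrable_norm_sub_sq hπ) ((integrable_logRatio hπ S S').const_mul _)]
  simp_rw [norm_sub_sq_add_logRatio hS hS' hε h]
  rw [integral_add (integrable_comp_fst hπ (hi A _)) (integrable_comp_snd hπ (hi B _)),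
    integral_comp_fst hπ (hc _), integral_comp_snd hπ (hc _), optValue]

theorem lintegral_norm_sub_sq (hπ : π ∈ couplings (gaussian A) (gaussian B)) :
    ∫⁻ p, ENNReal.ofReal (‖p.1 - p.2‖ ^ 2) ∂π = ENNReal.ofReal (∫ p, ‖p.1 - p.2‖ ^ 2 ∂π) :=
  (ofReal_integral_eq_lintegral_ofReal (integrable_norm_sub_sq hπ)
    (.of_forall fun _ => by positivity)).symm

theorem objective_ne_top_iff {S S' : BlockMat d} {ε : ℝ} (hS : S.PosDef)
    (hS' : S'.PosDef) (hε : 0 < ε) (hπ : π ∈ couplings (gaussian A) (gaussian B)) :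
    objective S ε π ≠ ∞ ↔ klDiv π (gaussianProd S') ≠ ∞ := by
  have := hπ.1
  rw [gaussianProd_eq_tilted hS hS', ← klDiv_ne_top_iff_tilted (integrable_exp_logRatio hS hS')
    (integrable_logRatio hπ S S'), objective, lintegral_norm_sub_sq hπ]
  simp [ENNReal.add_eq_top, ENNReal.mul_eq_top, hε]

/-- The cost and the integrated log-density combine into a quantity fixed by the marginals, leaving
only the entropy relative to `N(S')`. -/
theorem toReal_objective {S S' : BlockMat d} {ε : ℝ} (hS : S.PosDef)
    (hS' : S'.PosDef) (hε : 0 < ε)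
    (h : S⁻¹.toBlocks₁₂ - S'⁻¹.toBlocks₁₂ = ε⁻¹ • (1 : Mat d))
    (hπ : π ∈ couplings (gaussian A) (gaussian B)) (hfin : klDiv π (gaussianProd S') ≠ ∞) :
    (objective S ε π).toReal =
      optValue A B S S' ε + 2 * ε * (klDiv π (gaussianProd S')).toReal := by
  have := hπ.1
  have hexp := integrable_exp_logRatio hS hS'
  have hlog := integrable_logRatio hπ S S'
  have hfin' : klDiv π (gaussianProd S) ≠ ∞ := by
    rw [gaussianProd_eq_tilted hS hS'] at hfin
    exact (klDiv_ne_top_iff_tilted hexp hlog).2 hfin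
  rw [objective, lintegral_norm_sub_sq hπ,
    ENNReal.toReal_add ENNReal.ofReal_ne_top (ENNReal.mul_ne_top ENNReal.ofReal_ne_top hfin'),
    ENNReal.toReal_mul, ENNReal.toReal_ofReal (integral_nonneg fun _ => by positivity),
    ENNReal.toReal_ofReal (by positivity), toReal_klDiv_eq_tilted hexp hlog hfin',
    ← gaussianProd_eq_tilted hS hS', integral_exp_logRatio hS hS',
    ← integral_norm_sub_sq_add_logRatio hS hS' hε h hπ]
  ring

variable {C : Mat d} {S : BlockMat d} {ε : ℝ}

theorem objective_gaussianProd_ne_top (hA : A.PosDef) (hB : B.PosDef) (hS : S.PosDef)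
    (hS' : (jointCov A B C).PosDef) (hε : 0 < ε) :
    objective S ε (gaussianProd (jointCov A B C)) ≠ ∞ := by
  refine (objective_ne_top_iff hS hS' hε
    (gaussianProd_mem_couplings hA.posSemidef hB.posSemidef hS'.posSemidef)).2 ?_
  simp [klDiv_self]

theorem toReal_objective_gaussianProd (hA : A.PosDef) (hB : B.PosDef) (hS : S.PosDef)
    (hS' : (jointCov A B C).PosDef) (hε : 0 < ε)
    (h : S⁻¹.toBlocks₁₂ - (jointCov A B C)⁻¹.toBlocks₁₂ = ε⁻¹ • (1 : Mat d)) :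
    (objective S ε (gaussianProd (jointCov A B C))).toReal =
      optValue A B S (jointCov A B C) ε := by
  rw [toReal_objective hS hS' hε h
    (gaussianProd_mem_couplings hA.posSemidef hB.posSemidef hS'.posSemidef) (by simp [klDiv_self])]
  simp [klDiv_self]

/-- The Gaussian coupling whose precision matrix has the right off-diagonal block is the unique
solution of the entropic transport problem. -/
theorem isSolution_iff (hA : A.PosDef) (hB : B.PosDef) (hS : S.PosDef)
    (hS' : (jointCov A B C).PosDef) (hε : 0 < ε)
    (h : S⁻¹.toBlocks₁₂ - (jointCov A B C)⁻¹.toBlocks₁₂ = ε⁻¹ • (1 : Mat d)) :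
    IsSolution S ε (gaussian A) (gaussian B) π ↔ π = gaussianProd (jointCov A B C) := by
  have hmem := gaussianProd_mem_couplings hA.posSemidef hB.posSemidef hS'.posSemidef
  have htop := objective_gaussianProd_ne_top hA hB hS hS' hε
  have hval := toReal_objective_gaussianProd hA hB hS hS' hε h
  constructor
  · rintro ⟨hπ, hmin⟩
    have := hπ.1
    have hle := hmin _ hmem
    have hfin := (objective_ne_top_iff hS hS' hε hπ).1 (ne_top_of_le_ne_top htop hle)
    have hle' := ENNReal.toReal_mono htop hle
    rw [hval, toReal_objective hS hS' hε h hπ hfin] at hle'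
    -- Minimality leaves no room for positive entropy; zero entropy identifies the measures.
    have h0 : (klDiv π (gaussianProd (jointCov A B C))).toReal = 0 :=
      le_antisymm (by nlinarith) ENNReal.toReal_nonneg
    exact klDiv_eq_zero_iff.1 ((ENNReal.toReal_eq_zero_iff _).1 h0 |>.resolve_right hfin)
  · rintro rfl
    refine ⟨hmem, fun π' hπ' => ?_⟩
    by_cases hfin : objective S ε π' = ∞
    · simp [hfin]
    rw [← ENNReal.toReal_le_toReal htop hfin, hval,
      toReal_objective hS hS' hε h hπ' ((objective_ne_top_iff hS hS' hε hπ').1 hfin)]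
    exact le_add_of_nonneg_right (by positivity)

theorem cost_eq (hA : A.PosDef) (hB : B.PosDef) (hS : S.PosDef)
    (hS' : (jointCov A B C).PosDef) (hε : 0 < ε)
    (h : S⁻¹.toBlocks₁₂ - (jointCov A B C)⁻¹.toBlocks₁₂ = ε⁻¹ • (1 : Mat d)) :
    cost S ε (gaussian A) (gaussian B) = objective S ε (gaussianProd (jointCov A B C)) := by
  obtain ⟨hmem, hmin⟩ := (isSolution_iff hA hB hS hS' hε h).2 rfl
  exact le_antisymm (iInf₂_le _ hmem) (le_iInf₂ hmin)

end Coupling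

/-! ### The scalar case and the value of the cost -/

section OneDim

theorem of_one_eq_smul (v : ℝ) : (!![v] : Mat 1) = v • 1 := by
  ext i j
  fin_cases i
  fin_cases j
  simp

theorem posDef_of_one {v : ℝ} (hv : 0 < v) : (!![v] : Mat 1).PosDef := by
  rw [of_one_eq_smul]
  exact Matrix.PosDef.one.smul hv

theorem of_one_mul (v w : ℝ) : (!![v] : Mat 1) * !![w] = !![v * w] := by
  simp [of_one_eq_smul, smul_smul, mul_comm]

theorem of_one_add (v w : ℝ) : (!![v] : Mat 1) + !![w] = !![v + w] := by
  simp [of_one_eq_smul, add_smul]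

theorem of_one_sub (v w : ℝ) : (!![v] : Mat 1) - !![w] = !![v - w] := by
  simp [of_one_eq_smul, sub_smul]

theorem of_one_smul (v w : ℝ) : v • (!![w] : Mat 1) = !![v * w] := by
  simp [of_one_eq_smul, smul_smul]

theorem of_one_transpose (v : ℝ) : (!![v] : Mat 1)ᵀ = !![v] := by
  simp [of_one_eq_smul]

theorem of_one_one : (1 : Mat 1) = !![1] := by simp [of_one_eq_smul]

theorem of_one_inv {v : ℝ} (hv : v ≠ 0) : (!![v] : Mat 1)⁻¹ = !![v⁻¹] :=
  Matrix.inv_eq_right_inv (by rw [of_one_mul, mul_inv_cancel₀ hv, of_one_one])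

theorem sqrt_of_one {v w : ℝ} (hv : 0 ≤ v) (h : v * v = w) :
    CFC.sqrt (!![w] : Mat 1) = !![v] := by
  refine CFC.sqrt_unique (by rw [of_one_mul, h]) ?_
  rw [Matrix.nonneg_iff_posSemidef, of_one_eq_smul]
  exact Matrix.PosSemidef.one.smul hv

theorem isUnit_of_one_iff {v : ℝ} : IsUnit (!![v] : Mat 1) ↔ v ≠ 0 := by
  simp [Matrix.isUnit_iff_isUnit_det]

theorem det_cov2 (v w c : ℝ) : (cov2 v w c).det = v * w - c * c := by
  rw [← Matrix.det_submatrix_equiv_self finSumFinEquiv.symm, Matrix.det_fin_two]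
  have h0 : (finSumFinEquiv (m := 1) (n := 1)).symm 0 = Sum.inl 0 := by decide
  have h1 : (finSumFinEquiv (m := 1) (n := 1)).symm 1 = Sum.inr 0 := by decide
  simp [h0, h1, cov2]

theorem inv_cov2 {v w c : ℝ} (h : v * w - c * c ≠ 0) :
    (cov2 v w c)⁻¹ = cov2 (w / (v * w - c * c)) (v / (v * w - c * c)) (-c / (v * w - c * c)) := by
  generalize hΔ : v * w - c * c = Δ at h ⊢
  refine Matrix.inv_eq_right_inv ?_
  rw [cov2, cov2, Matrix.fromBlocks_multiply, ← Matrix.fromBlocks_one, of_one_one]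
  simp only [of_one_mul, of_one_add]
  have hz : (0 : Mat 1) = !![0] := by simp [of_one_eq_smul]
  rw [hz]
  congr 4 <;> field_simp <;> first | ring1 | linear_combination hΔ

theorem jointCov_of_one (v w c : ℝ) : jointCov !![v] !![w] !![c] = cov2 v w c := by
  rw [jointCov, cov2, of_one_transpose]

theorem refCov_of_one {a b : ℝ} (ha : 0 < a) (hb : 0 < b) (ρ : ℝ) :
    refCov !![a ^ 2] !![b ^ 2] !![ρ] = cov2 (a ^ 2) (b ^ 2) (a * ρ * b) := by
  rw [refCov, cov2, sqrt_of_one ha.le (sq a).symm, sqrt_of_one hb.le (sq b).symm,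
    of_one_transpose]
  simp only [of_one_mul]
  rw [show b * ρ * a = a * ρ * b by ring]

theorem posDef_one_sub_of_one {ρ : ℝ} (h1 : -1 < ρ) (h2 : ρ < 1) :
    (1 - (!![ρ] : Mat 1) * (!![ρ] : Mat 1)ᵀ).PosDef := by
  rw [of_one_transpose, of_one_mul, of_one_one, of_one_sub]
  exact posDef_of_one (by nlinarith)

theorem Nmat_of_one {a b ρ : ℝ} (ha : 0 < a) (hb : 0 < b) (h1 : -1 < ρ) (h2 : ρ < 1) (ε : ℝ) :
    Nmat !![a ^ 2] !![b ^ 2] !![ρ] ε = !![a * b + ε * ρ / (1 - ρ ^ 2)] := by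
  have h : 1 - ρ * ρ ≠ 0 := by nlinarith
  rw [Nmat, sqrt_of_one ha.le (sq a).symm, sqrt_of_one hb.le (sq b).symm, of_one_transpose,
    of_one_mul ρ, of_one_one, of_one_sub, of_one_inv h, of_one_mul, of_one_mul, of_one_smul,
    of_one_add]
  rw [sq ρ, mul_div_assoc, div_eq_mul_inv]

theorem Ceps_of_one {a b ρ ε : ℝ} (ha : 0 < a) (hb : 0 < b) (h1 : -1 < ρ) (h2 : ρ < 1)
    (hn : a * b + ε * ρ / (1 - ρ ^ 2) ≠ 0) :
    Ceps !![a ^ 2] !![b ^ 2] !![ρ] ε =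
      !![(√((a * b + ε * ρ / (1 - ρ ^ 2)) ^ 2 + ε ^ 2 / 4) - ε / 2) *
        (a * b * (1 - ρ ^ 2) / (a * b * (1 - ρ ^ 2) + ε * ρ))] := by
  have h : 1 - ρ ^ 2 ≠ 0 := by nlinarith
  have hs : √((a * b + ε * ρ / (1 - ρ ^ 2)) ^ 2 + ε ^ 2 / 4) *
      √((a * b + ε * ρ / (1 - ρ ^ 2)) ^ 2 + ε ^ 2 / 4) =
      (a * b + ε * ρ / (1 - ρ ^ 2)) * (a * b + ε * ρ / (1 - ρ ^ 2)) + ε ^ 2 / 4 * 1 := by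
    rw [Real.mul_self_sqrt (by positivity)]
    ring
  rw [Ceps, Nmat_of_one ha hb h1 h2, sqrt_of_one ha.le (sq a).symm, sqrt_of_one hb.le (sq b).symm,
    of_one_transpose, of_one_mul, of_one_one, of_one_smul, of_one_add,
    sqrt_of_one (Real.sqrt_nonneg _) hs, of_one_smul, of_one_sub, of_one_mul, of_one_inv hn,
    of_one_mul, of_one_mul]
  have hn' : a * b * (1 - ρ ^ 2) + ε * ρ = (a * b + ε * ρ / (1 - ρ ^ 2)) * (1 - ρ ^ 2) := by
    field_simp
  rw [hn', mul_div_mul_right _ _ h, mul_one]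
  congr 3
  ring

theorem integral_sq_gaussian {v : ℝ} (hv : 0 < v) :
    ∫ x, (x 0) ^ 2 ∂(gaussian (!![v] : Mat 1)) = v := by
  have hm := measurePreserving_eval_multivariateGaussian (μ := (0 : Euc 1))
    (posDef_of_one hv).posSemidef (i := 0)
  have h : ∫ x, (x 0) ^ 2 ∂(gaussian (!![v] : Mat 1)) =
      ∫ t, t ^ 2 ∂(gaussianReal 0 v.toNNReal) := by
    have := hm.map_eq
    simp only [PiLp.zero_apply, Matrix.of_apply, Matrix.cons_val', Matrix.cons_val_zero] at this
    rw [gaussian, ← this, integral_map (by fun_prop) (by fun_prop)]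
  -- The law is centered, so its second moment is its variance.
  have h2 := variance_of_integral_eq_zero (X := id) (μ := gaussianReal 0 v.toNNReal)
    (by fun_prop) (by simp)
  rw [variance_id_gaussianReal] at h2
  rw [h]
  simpa [hv.le] using h2.symm

theorem integral_norm_sq_add_quad {v : ℝ} (hv : 0 < v) (ε q : ℝ) :
    ∫ x, (‖x‖ ^ 2 + ε * quad !![q] x) ∂(gaussian (!![v] : Mat 1)) = (1 + ε * q) * v := by
  have : ∀ x : Euc 1, ‖x‖ ^ 2 + ε * quad !![q] x = (1 + ε * q) * (x 0) ^ 2 := fun x => by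
    rw [EuclideanSpace.real_norm_sq_eq, of_one_eq_smul, quad, Matrix.smul_mulVec,
      Matrix.one_mulVec]
    simp [dotProduct]
    ring
  simp_rw [this]
  rw [integral_const_mul, integral_sq_gaussian hv]

theorem optValue_cov2 {v w c c' : ℝ} (hv : 0 < v) (hw : 0 < w) (hc : 0 < v * w - c * c)
    (hc' : 0 < v * w - c' * c') (ε : ℝ) :
    optValue !![v] !![w] (cov2 v w c) (cov2 v w c') ε =
      v + w + 2 * ε * (v * w / (v * w - c * c) - v * w / (v * w - c' * c')) -
        ε * (Real.log (v * w - c' * c') - Real.log (v * w - c * c)) := by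
  have h11 (x y z x' y' z' : ℝ) : (cov2 x y z - cov2 x' y' z').toBlocks₁₁ = !![x - x'] := by
    rw [← of_one_sub]; rfl
  have h22 (x y z x' y' z' : ℝ) : (cov2 x y z - cov2 x' y' z').toBlocks₂₂ = !![y - y'] := by
    rw [← of_one_sub]; rfl
  rw [optValue, inv_cov2 hc.ne', inv_cov2 hc'.ne', h11, h22, integral_norm_sq_add_quad hv,
    integral_norm_sq_add_quad hw, det_cov2, det_cov2,
    Real.log_div (Real.sqrt_pos.2 hc').ne' (Real.sqrt_pos.2 hc).ne', Real.log_sqrt hc'.le,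
    Real.log_sqrt hc.le]
  ring

/-- The entropic cost in dimension one. -/
theorem optValue_one {a b ρ ε : ℝ} (ha : 0 < a) (hb : 0 < b) (h1 : -1 < ρ) (h2 : ρ < 1)
    (hε : 0 < ε) (hn : a * b + ε * ρ / (1 - ρ ^ 2) ≠ 0) :
    optValue !![a ^ 2] !![b ^ 2] (cov2 (a ^ 2) (b ^ 2) (a * ρ * b))
        (cov2 (a ^ 2) (b ^ 2) ((√((a * b + ε * ρ / (1 - ρ ^ 2)) ^ 2 + ε ^ 2 / 4) - ε / 2) *
          (a * b * (1 - ρ ^ 2) / (a * b * (1 - ρ ^ 2) + ε * ρ)))) ε =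
      a ^ 2 + b ^ 2 - 2 * √((a * b + ε * ρ / (1 - ρ ^ 2)) ^ 2 + ε ^ 2 / 4)
        + ε * Real.log (√((a * b + ε * ρ / (1 - ρ ^ 2)) ^ 2 + ε ^ 2 / 4) + ε / 2)
        + 2 * ε * (1 - ρ ^ 2)⁻¹ - ε - ε * Real.log ε + ε * Real.log (1 - ρ ^ 2) := by
  have hρ : 0 < 1 - ρ ^ 2 := by nlinarith
  have hn' : a * b * (1 - ρ ^ 2) + ε * ρ = (a * b + ε * ρ / (1 - ρ ^ 2)) * (1 - ρ ^ 2) := by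
    field_simp
  rw [hn', mul_div_mul_right _ _ hρ.ne']
  generalize a * b + ε * ρ / (1 - ρ ^ 2) = n at hn
  have hss : √(n ^ 2 + ε ^ 2 / 4) ^ 2 = n ^ 2 + ε ^ 2 / 4 := Real.sq_sqrt (by positivity)
  have hs0 : 0 ≤ √(n ^ 2 + ε ^ 2 / 4) := Real.sqrt_nonneg _
  generalize √(n ^ 2 + ε ^ 2 / 4) = s at hss hs0
  have hsp : 0 < s + ε / 2 := by positivity
  have hΔ : a ^ 2 * b ^ 2 - a * ρ * b * (a * ρ * b) = a ^ 2 * b ^ 2 * (1 - ρ ^ 2) := by ring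
  -- Scalar form of `1 - T Tᵀ = ε P⁻¹`, with `P = s + ε/2` and `T = (s - ε/2)/n`.
  have hτ : 1 - (s - ε / 2) ^ 2 / n ^ 2 = ε / (s + ε / 2) := by
    have hn2 : n ^ 2 = (s - ε / 2) * (s + ε / 2) := by linear_combination -hss
    have hm : s - ε / 2 ≠ 0 := fun h0 => hn (by simpa [h0] using hn2)
    rw [hn2, sq, mul_div_mul_left _ _ hm, one_sub_div hsp.ne']
    congr 1
    ring
  have hΔ' : a ^ 2 * b ^ 2 - (s - ε / 2) * (a * b / n) * ((s - ε / 2) * (a * b / n)) =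
      a ^ 2 * b ^ 2 * (ε / (s + ε / 2)) := by
    rw [← hτ]
    ring
  have hab : 0 < a ^ 2 * b ^ 2 := by positivity
  rw [optValue_cov2 (by positivity) (by positivity) (by rw [hΔ]; positivity)
    (by rw [hΔ']; positivity), hΔ, hΔ', Real.log_mul hab.ne' (by positivity),
    Real.log_mul hab.ne' hρ.ne', Real.log_div hε.ne' hsp.ne', div_mul_cancel_left₀ hab.ne',
    div_mul_cancel_left₀ hab.ne', inv_div]
  field_simp
  ring

end OneDim

end GaussianEOT

theorem mainTheorem5 :
    (∀ (d : ℕ) (A B R : Mat d) (ε : ℝ), A.PosDef → B.PosDef → opNorm R < 1 → 0 < ε →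
      IsUnit (Meps (refCov A B R) ε) →
        IsUnit (Nmat A B R ε) ∧
        (jointCov A B (Ceps A B R ε)).PosDef ∧
        ∀ π : Measure (Euc d × Euc d),
          IsSolution (refCov A B R) ε (gaussian A) (gaussian B) π ↔
            π = gaussianProd (jointCov A B (Ceps A B R ε))) ∧
    (∀ a b ρ ε : ℝ, 0 < a → 0 < b → -1 < ρ → ρ < 1 → 0 < ε →
      IsUnit (Meps (cov2 (a ^ 2) (b ^ 2) (a * ρ * b)) ε) →
        a * b * (1 - ρ ^ 2) + ε * ρ ≠ 0 ∧
        (∀ π : Measure (Euc 1 × Euc 1),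
          IsSolution (cov2 (a ^ 2) (b ^ 2) (a * ρ * b)) ε
              (gaussian !![a ^ 2]) (gaussian !![b ^ 2]) π ↔
            π = gaussianProd (cov2 (a ^ 2) (b ^ 2)
              ((√((a * b + ε * ρ / (1 - ρ ^ 2)) ^ 2 + ε ^ 2 / 4) - ε / 2) *
                (a * b * (1 - ρ ^ 2) / (a * b * (1 - ρ ^ 2) + ε * ρ))))) ∧
        cost (cov2 (a ^ 2) (b ^ 2) (a * ρ * b)) ε
          (gaussian !![a ^ 2]) (gaussian !![b ^ 2]) ≠ ∞ ∧
        (cost (cov2 (a ^ 2) (b ^ 2) (a * ρ * b)) ε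
            (gaussian !![a ^ 2]) (gaussian !![b ^ 2])).toReal =
          a ^ 2 + b ^ 2 - 2 * √((a * b + ε * ρ / (1 - ρ ^ 2)) ^ 2 + ε ^ 2 / 4)
            + ε * Real.log (√((a * b + ε * ρ / (1 - ρ ^ 2)) ^ 2 + ε ^ 2 / 4) + ε / 2)
            + 2 * ε * (1 - ρ ^ 2)⁻¹ - ε - ε * Real.log ε + ε * Real.log (1 - ρ ^ 2)) := by
  refine ⟨fun d A B R ε hA hB hR hε hM => ?_, fun a b ρ ε ha hb h1 h2 hε hM => ?_⟩
  · have hR' := posDef_one_sub_mul_transpose hR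
    have hN := isUnit_Nmat hA hB hR' hM
    have hS' := posDef_jointCov_Ceps hA hB hε hN
    exact ⟨hN, hS', fun π => isSolution_iff hA hB (posDef_refCov hA hB hR') hS' hε
      (inv_jointCov_Ceps_toBlocks₁₂ hA hB hR' hε hN)⟩
  · have hA := posDef_of_one (pow_pos ha 2)
    have hB := posDef_of_one (pow_pos hb 2)
    have hR := posDef_one_sub_of_one h1 h2
    have hS := posDef_refCov hA hB hR
    have hN := isUnit_Nmat (ε := ε) hA hB hR (by rwa [refCov_of_one ha hb])
    have hn := hN
    rw [Nmat_of_one ha hb h1 h2, isUnit_of_one_iff] at hn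
    have hS' := posDef_jointCov_Ceps hA hB hε hN
    have hoff := inv_jointCov_Ceps_toBlocks₁₂ hA hB hR hε hN
    -- The matrix facts are rewritten in scalar form, so the general uniqueness and value results
    -- apply directly.
    rw [refCov_of_one ha hb] at hS hoff
    rw [Ceps_of_one ha hb h1 h2 hn] at hS' hoff
    have hcost := cost_eq hA hB hS hS' hε hoff
    have hρ : 1 - ρ ^ 2 ≠ 0 := by nlinarith
    refine ⟨fun h0 => hn ?_, fun π => ?_, ?_, ?_⟩
    · rw [← mul_div_cancel_right₀ (a * b) hρ, ← add_div, h0, zero_div]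
    · have h := isSolution_iff (π := π) hA hB hS hS' hε hoff
      rwa [jointCov_of_one] at h
    · rw [hcost]
      exact objective_gaussianProd_ne_top hA hB hS hS' hε
    · rw [hcost, toReal_objective_gaussianProd hA hB hS hS' hε hoff, jointCov_of_one]
      exact optValue_one ha hb h1 h2 hε hn
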